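/- A \emph{disc packing} of $\mathbb{R}^2$ is a family $\mathcal{P}$ of circles of positive radius whose interiors (the open discs they bound) are pairwise disjoint; $\mathrm{radii}(\mathcal{P})$ denotes the set of radii of its members. The \emph{contact hypergraph} of $\mathcal{P}$ has as vertices the centers of the circles in $\mathcal{P}$; its hyperedges are the nonempty sets $E$ of at most three vertices such that (i) for any two distinct $a,b\in E$ the circles of $\mathcal{P}$ centered at $a$ and $b$ are tangent, and (ii) every vertex lying in the convex hull of $E$ belongs to $E$. The packing $\mathcal{P}$ is \emph{compact} if its contact hypergraph is exactly the vertex scheme (the family of vertex sets of the simplices) of a simplicial complex in $\mathbb{R}^2$ in which every simplex is contained in a $2$-simplex of the complex, and whose underlying space is homeomorphic to $\mathbb{R}^2$ through the identity map (that is, the simplices cover $\mathbb{R}^2$, and the topology coherent with the simplices is the Euclidean one). For $n\in\mathbb{N}$ let \[ \Pi_{2,n}:=\{\mathrm{radii}(\mathcal{P}) : \mathcal{P}\text{ a compact disc packing of }\mathbb{R}^2,\ |\mathrm{radii}(\mathcal{P})|=n,\ \max \mathrm{radii}(\mathcal{P})=1\}. \] \textbf{Theorem.} For every $n\in\mathbb{N}$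 with $n\ge 2$, the set $\Pi_{2,n}$ is finite. -/

import Mathlib

open EuclideanGeometry

/-- A sphere packing of `ℝ^d`: a family of spheres (of positive radius) whose interiors,
i.e. the open balls that they bound, are pairwise disjoint. -/
structure IsSpherePacking {d : ℕ} (P : Set (Sphere (EuclideanSpace ℝ (Fin d)))) : Prop where
  radius_pos : ∀ A ∈ P, 0 < A.radius
  disjoint_interiors : P.Pairwise fun A B =>
    Disjoint (Metric.ball A.center A.radius) (Metric.ball B.center B.radius)

/-- The set of radii of the spheres of `P`. -/
def sphereRadii {d : ℕ} (P : Set (Sphere (EuclideanSpace ℝ (Fin d)))) : Set ℝ :=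
  {r | ∃ A ∈ P, A.radius = r}

/-- The set of centers of the spheres of `P`: the vertex set of the contact hypergraph. -/
def sphereCenters {d : ℕ} (P : Set (Sphere (EuclideanSpace ℝ (Fin d)))) :
    Set (EuclideanSpace ℝ (Fin d)) :=
  {c | ∃ A ∈ P, A.center = c}

/-- `E` is a hyperedge of the contact hypergraph of `P`: a (nonempty) set of at most `d + 1`
centers such that any two distinct spheres of `P` with centers in `E` are tangent, and such that
every center that lies in the convex hull of `E` is an element of `E`.
(Spheres with disjoint interiors can only be tangent externally.) -/
structure IsContactHyperedge {d : ℕ} (P : Set (Sphere (EuclideanSpace ℝ (Fin d))))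
    (E : Finset (EuclideanSpace ℝ (Fin d))) : Prop where
  nonempty : E.Nonempty
  subset_centers : (E : Set (EuclideanSpace ℝ (Fin d))) ⊆ sphereCenters P
  card_le : E.card ≤ d + 1
  tangent : ∀ A ∈ P, ∀ B ∈ P, A.center ∈ E → B.center ∈ E → A.center ≠ B.center →
    A.IsExtTangent B
  mem_of_mem_convexHull : ∀ c ∈ sphereCenters P,
    c ∈ convexHull ℝ (E : Set (EuclideanSpace ℝ (Fin d))) → c ∈ E

/-- A simplicial complex in `ℝ^d` is a homogeneous simplicial `d`-complex if every simplex of it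
is a face of a `d`-simplex (a simplex with `d + 1` vertices) of it. -/
def IsHomogeneousComplex {d : ℕ}
    (K : Geometry.SimplicialComplex ℝ (EuclideanSpace ℝ (Fin d))) : Prop :=
  ∀ s ∈ K.faces, ∃ t ∈ K.faces, s ⊆ t ∧ t.card = d + 1

/-- The underlying topological space of `K` is homeomorphic to `ℝ^d` through the identity map:
the simplices cover `ℝ^d`, and the Euclidean topology is the topology of the underlying space,
i.e. the one that is coherent with the family of all (geometric) simplices. -/
structure IsTessellation {d : ℕ}
    (K : Geometry.SimplicialComplex ℝ (EuclideanSpace ℝ (Fin d))) : Prop where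
  space_eq : K.space = Set.univ
  coherent : Topology.IsCoherentWith
    {S : Set (EuclideanSpace ℝ (Fin d)) | ∃ s ∈ K.faces, S = convexHull ℝ (s : Set _)}

/-- A sphere packing is compact if its contact hypergraph is the vertex scheme of a homogeneous
simplicial `d`-complex in `ℝ^d` whose underlying space is homeomorphic to `ℝ^d` through the
identity map. -/
def IsCompactPacking {d : ℕ} (P : Set (Sphere (EuclideanSpace ℝ (Fin d)))) : Prop :=
  IsSpherePacking P ∧
    ∃ K : Geometry.SimplicialComplex ℝ (EuclideanSpace ℝ (Fin d)),
      IsHomogeneousComplex K ∧ IsTessellation K ∧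
        ∀ E : Finset (EuclideanSpace ℝ (Fin d)), E ∈ K.faces ↔ IsContactHyperedge P E

/-- The set `Π_{d,n}` of all sets of radii of compact sphere packings of `ℝ^d` with exactly `n`
radii, the largest of which is `1`. -/
def radiusConfigurations (d n : ℕ) : Set (Set ℝ) :=
  {R | ∃ P : Set (Sphere (EuclideanSpace ℝ (Fin d))),
    IsCompactPacking P ∧ R = sphereRadii P ∧ R.encard = n ∧ IsGreatest R 1}

/-!
A compact packing is rigid once finitely many of its coronas are known. Two mutually tangent
neighbours of a disc, with curvatures (inverse radii) `κ₁`, `κ₂` relative to the disc, are seen from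
its centre under the angle `cornerAngle κ₁ κ₂ = arccos (1 - 2 / ((1 + κ₁) (1 + κ₂)))`, which is
strictly decreasing in both variables and remains meaningful for a neighbour of curvature `0`.

*Geometry.* The triangles around a vertex of the contact complex are finite in number and their
angles there add up to `2π` (`exists_star_angle_sum`): a cone with angle `θ` meets the unit disc in
area `θ / 2`, the open cones of the triangles are disjoint, and the closed ones cover the plane
because the star of a vertex is a neighbourhood of it. Since the plane is connected, any splitting
of the radii into two nonempty classes is visible in some corona
(`IsCompactPacking.exists_corona`).

*Rigidity.* If there were infinitely many sets of radii, scale the curvatures of each so that the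
largest, that of the smallest disc, is `1`, and take the limits `κ'` along a nonprincipal
ultrafilter; a limit curvature may be `0`. Around a disc whose limit curvature is positive the
number of neighbours stays bounded, so the combinatorial type of its corona is eventually constant
and the limit satisfies the same angle equation. Compare a nearby curvature system `κ` with `κ'` on
the set `M` of types where `κ' / κ` is largest. If `M` is not everything, a corona of a type in `M`
that sees a type outside `M` has a strictly larger angle sum for `κ'` than for `κ`
(`coronaSum_lt`), but both sums are `2π`. So `κ` and `κ'` are proportional, hence equal
(`eventually_eq_of_hasCoronas`), while the curvature systems determine the sets of radii. This
contradicts the choice of the ultrafilter.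
-/

open Filter Topology MeasureTheory

/-! ### The angle between two mutually tangent neighbours of a disc -/

/-- The angle at the centre of a disc of radius `x` between the centres of two discs of radii `y`
and `z`, all three mutually tangent, as a function of the ratios `u = x / y` and `v = x / z`.
With these ratios as variables, the value `0` describes a neighbour of infinite radius. -/
noncomputable def cornerAngle (u v : ℝ) : ℝ :=
  Real.arccos (1 - 2 / ((1 + u) * (1 + v)))

lemma two_div_mem_Icc {u v : ℝ} (hu : 0 ≤ u) (hv : 0 ≤ v) :
    0 < 2 / ((1 + u) * (1 + v)) ∧ 2 / ((1 + u) * (1 + v)) ≤ 2 := by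
  have h : 1 ≤ (1 + u) * (1 + v) := by nlinarith [mul_nonneg hu hv]
  exact ⟨by positivity, div_le_self (by norm_num) h⟩

lemma cornerAngle_pos {u v : ℝ} (hu : 0 ≤ u) (hv : 0 ≤ v) : 0 < cornerAngle u v := by
  have := two_div_mem_Icc hu hv
  exact Real.arccos_pos.2 (by linarith)

lemma cornerAngle_le {u v u' v' : ℝ} (hu : 0 ≤ u) (hv : 0 ≤ v) (hu' : u ≤ u') (hv' : v ≤ v') :
    cornerAngle u' v' ≤ cornerAngle u v := by
  apply Real.arccos_le_arccos
  have : 0 ≤ 1 + u' := by linarith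
  gcongr

lemma cornerAngle_lt {u v u' v' : ℝ} (hu : 0 ≤ u) (hv : 0 ≤ v) (hu' : u ≤ u') (hv' : v ≤ v')
    (h : u < u' ∨ v < v') : cornerAngle u' v' < cornerAngle u v := by
  have h1 := two_div_mem_Icc hu hv
  have h2 := two_div_mem_Icc (hu.trans hu') (hv.trans hv')
  have h3 : (1 + u) * (1 + v) < (1 + u') * (1 + v') := by
    rcases h with h | h <;> nlinarith
  have h4 : 2 / ((1 + u') * (1 + v')) < 2 / ((1 + u) * (1 + v)) := by
    gcongr
  exact Real.strictAntiOn_arccos ⟨by linarith, by linarith⟩ ⟨by linarith, by linarith⟩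
    (by linarith)

lemma Filter.Tendsto.cornerAngle {α : Type*} {l : Filter α} {f g : α → ℝ} {u v : ℝ}
    (hf : Tendsto f l (𝓝 u)) (hg : Tendsto g l (𝓝 v)) (hu : 0 ≤ u) (hv : 0 ≤ v) :
    Tendsto (fun a => cornerAngle (f a) (g a)) l (𝓝 (cornerAngle u v)) := by
  have h : (1 + u) * (1 + v) ≠ 0 := by positivity
  exact (Real.continuous_arccos.tendsto _).comp
    (tendsto_const_nhds.sub (tendsto_const_nhds.div
      ((tendsto_const_nhds.add hf).mul (tendsto_const_nhds.add hg)) h))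

/-! ### Rigidity of coronas -/

/-- The sum of the angles at a disc of type `i` over a list of tangent pairs of neighbours given by
their types; here `κ` is the curvature (the inverse radius, up to scale) of each type. -/
noncomputable def coronaSum {ι : Type*} (κ : ι → ℝ) (i : ι) (l : List (ι × ι)) : ℝ :=
  (l.map fun p => cornerAngle (κ p.1 / κ i) (κ p.2 / κ i)).sum

lemma tendsto_coronaSum {ι α : Type*} {f : Filter α} {κ : α → ι → ℝ} {κ' : ι → ℝ}
    (hlim : ∀ i, Tendsto (fun a => κ a i) f (𝓝 (κ' i))) (h0 : ∀ i, 0 ≤ κ' i) {i : ι}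
    (hi : 0 < κ' i) (l : List (ι × ι)) :
    Tendsto (fun a => coronaSum (κ a) i l) f (𝓝 (coronaSum κ' i l)) := by
  unfold coronaSum
  refine tendsto_list_sum l fun p _ => ?_
  exact ((hlim _).div (hlim _) hi.ne').cornerAngle ((hlim _).div (hlim _) hi.ne')
    (div_nonneg (h0 _) hi.le) (div_nonneg (h0 _) hi.le)

/-- The discrete maximum principle: among two curvature systems, at a type `i` where the ratio
`κ' / κ` is largest, the system `κ'` has the larger angles, strictly so if a neighbour has a
smaller ratio. -/
lemma coronaSum_lt {ι : Type*} {κ κ' : ι → ℝ} (hκ : ∀ i, 0 < κ i) (h0 : ∀ i, 0 ≤ κ' i) {i : ι}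
    (hi : 0 < κ' i) (hmax : ∀ j, κ' j / κ j ≤ κ' i / κ i) {l : List (ι × ι)}
    (hl : ∃ p ∈ l, κ' p.1 / κ p.1 < κ' i / κ i ∨ κ' p.2 / κ p.2 < κ' i / κ i) :
    coronaSum κ i l < coronaSum κ' i l := by
  have key : ∀ j, κ' j / κ' i ≤ κ j / κ i := fun j => by
    have := hmax j
    rw [div_le_div_iff₀ (hκ _) (hκ _)] at this
    rw [div_le_div_iff₀ hi (hκ _)]
    linarith
  have key' : ∀ j, κ' j / κ j < κ' i / κ i → κ' j / κ' i < κ j / κ i := fun j this => by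
    rw [div_lt_div_iff₀ (hκ _) (hκ _)] at this
    rw [div_lt_div_iff₀ hi (hκ _)]
    linarith
  refine List.sum_lt_sum _ _ (fun p _ => ?_) ?_
  · exact cornerAngle_le (div_nonneg (h0 _) hi.le) (div_nonneg (h0 _) hi.le) (key _) (key _)
  · obtain ⟨p, hp, h⟩ := hl
    exact ⟨p, hp, cornerAngle_lt (div_nonneg (h0 _) hi.le) (div_nonneg (h0 _) hi.le)
      (key _) (key _) (h.imp (key' _) (key' _))⟩

/-- A list of pairs of neighbours around a disc whose curvature is not too small is short, since
every angle is bounded below. -/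
lemma length_le_of_coronaSum {ι : Type*} {κ : ι → ℝ} (hκ : ∀ i, 0 < κ i) (h1 : ∀ i, κ i ≤ 1)
    {i : ι} {ε : ℝ} (hε : 0 < ε) (hi : ε ≤ κ i) {l : List (ι × ι)}
    (hl : coronaSum κ i l = 2 * Real.pi) :
    l.length ≤ ⌊2 * Real.pi / cornerAngle ε⁻¹ ε⁻¹⌋₊ := by
  have hpos : 0 < cornerAngle ε⁻¹ ε⁻¹ := cornerAngle_pos (by positivity) (by positivity)
  have hj : ∀ j, κ j / κ i ≤ ε⁻¹ := fun j => by
    rw [inv_eq_one_div]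
    exact div_le_div₀ zero_le_one (h1 j) hε hi
  apply Nat.le_floor
  rw [le_div_iff₀ hpos, ← hl, ← nsmul_eq_mul]
  have := List.card_nsmul_le_sum
    (l.map fun p => cornerAngle (κ p.1 / κ i) (κ p.2 / κ i)) (cornerAngle ε⁻¹ ε⁻¹) (by
      intro x hx
      obtain ⟨p, -, rfl⟩ := List.mem_map.1 hx
      exact cornerAngle_le (div_nonneg (hκ _).le (hκ _).le) (div_nonneg (hκ _).le (hκ _).le)
        (hj _) (hj _))
  simpa [coronaSum] using this

/-- `HasCoronas κ` says that, for every nonempty proper set `M` of types, some type in `M` has a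
closed corona, with total angle `2π`, that contains a type outside `M`. -/
def HasCoronas {ι : Type*} (κ : ι → ℝ) : Prop :=
  ∀ M : Set ι, M.Nonempty → M ≠ Set.univ → ∃ i ∈ M, ∃ l : List (ι × ι),
    coronaSum κ i l = 2 * Real.pi ∧ ∃ p ∈ l, p.1 ∉ M ∨ p.2 ∉ M

/-- Curvature systems with coronas are isolated, even within the systems that allow the
curvature `0`: a family of them cannot converge without being eventually constant. -/
theorem eventually_eq_of_hasCoronas {ι α : Type*} [Finite ι] {𝒰 : Ultrafilter α}
    {κ : α → ι → ℝ} {κ' : ι → ℝ} (hκ : ∀ a i, 0 < κ a i) (h1 : ∀ a i, κ a i ≤ 1) (i₀ : ι)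
    (hi₀ : ∀ a, κ a i₀ = 1) (hcor : ∀ a, HasCoronas (κ a))
    (hlim : ∀ i, Tendsto (fun a => κ a i) 𝒰 (𝓝 (κ' i))) : ∀ᶠ a in 𝒰, κ a = κ' := by
  have h0 : ∀ i, 0 ≤ κ' i := fun i => ge_of_tendsto' (hlim i) fun a => (hκ a i).le
  have hi₀' : κ' i₀ = 1 := tendsto_nhds_unique (hlim i₀) (by simp [hi₀])
  -- The coronas needed for one set `M` of types of positive limit curvature.
  have step : ∀ M : Set ι, (M.Nonempty ∧ M ≠ Set.univ ∧ ∀ i ∈ M, 0 < κ' i) →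
      ∃ q : ι × List (ι × ι), q.1 ∈ M ∧ (∃ p ∈ q.2, p.1 ∉ M ∨ p.2 ∉ M) ∧
        coronaSum κ' q.1 q.2 = 2 * Real.pi ∧
        ∀ᶠ a in 𝒰, coronaSum (κ a) q.1 q.2 = 2 * Real.pi := by
    rintro M ⟨hM, hM', hMpos⟩
    obtain ⟨ε, hε, hεM⟩ : ∃ ε > 0, ∀ i ∈ M, ε < κ' i := by
      obtain ⟨j, hj, hmin⟩ := Set.exists_min_image M κ' M.toFinite hM
      exact ⟨κ' j / 2, half_pos (hMpos j hj),
        fun i hi => (half_lt_self (hMpos j hj)).trans_le (hmin i hi)⟩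
    have hev : ∀ᶠ a in 𝒰, ∀ i ∈ M, ε ≤ κ a i :=
      (eventually_all_finite M.toFinite).2 fun i hi =>
        ((hlim i).eventually (lt_mem_nhds (hεM i hi))).mono fun a h => h.le
    set B := ⌊2 * Real.pi / cornerAngle ε⁻¹ ε⁻¹⌋₊
    have hfin : (Set.univ ×ˢ {l | l.length ≤ B} : Set (ι × List (ι × ι))).Finite :=
      Set.finite_univ.prod (List.finite_length_le _ _)
    have hex : ∀ᶠ a in 𝒰, ∃ q ∈ (Set.univ ×ˢ {l | l.length ≤ B} : Set (ι × List (ι × ι))),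
        q.1 ∈ M ∧ (∃ p ∈ q.2, p.1 ∉ M ∨ p.2 ∉ M) ∧ coronaSum (κ a) q.1 q.2 = 2 * Real.pi := by
      filter_upwards [hev] with a ha
      obtain ⟨i, hi, l, hl, hp⟩ := hcor a M hM hM'
      exact ⟨(i, l), ⟨trivial, length_le_of_coronaSum (hκ a) (h1 a) hε (ha i hi) hl⟩, hi, hp, hl⟩
    obtain ⟨q, -, hq⟩ := (Ultrafilter.eventually_exists_mem_iff hfin).1 hex
    obtain ⟨a, hqM, hp, -⟩ := hq.exists
    have hq' : ∀ᶠ a in 𝒰, coronaSum (κ a) q.1 q.2 = 2 * Real.pi := hq.mono fun a h => h.2.2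
    exact ⟨q, hqM, hp, tendsto_nhds_unique (tendsto_coronaSum hlim h0 (hMpos _ hqM) _)
      (tendsto_const_nhds.congr' (hq'.mono fun a h => h.symm)), hq'⟩
  have : Nonempty ι := ⟨i₀⟩
  choose! q hqM hp hq' hq using step
  have hall : ∀ᶠ a in 𝒰, ∀ M ∈ {M : Set ι | M.Nonempty ∧ M ≠ Set.univ ∧ ∀ i ∈ M, 0 < κ' i},
      coronaSum (κ a) (q M).1 (q M).2 = 2 * Real.pi :=
    (eventually_all_finite (Set.toFinite _)).2 hq
  filter_upwards [hall] with a ha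
  obtain ⟨m, hm⟩ := Finite.exists_max fun i => κ' i / κ a i
  have hmpos : 0 < κ' m / κ a m :=
    lt_of_lt_of_le (by simp [hi₀, hi₀']) (hm i₀)
  -- The types where `κ' / κ` is largest; by the maximum principle these are all the types.
  set M : Set ι := {i | κ' i / κ a i = κ' m / κ a m} with hMdef
  have hMuniv : M = Set.univ := by
    by_contra hne
    have hM : M.Nonempty ∧ M ≠ Set.univ ∧ ∀ i ∈ M, 0 < κ' i := by
      refine ⟨⟨m, rfl⟩, hne, fun i hi => ?_⟩
      have : 0 < κ' i / κ a i := by rw [hMdef, Set.mem_ofPred_eq] at hi; rwa [hi]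
      exact (div_pos_iff_of_pos_right (hκ a i)).1 this
    have hqm : κ' (q M).1 / κ a (q M).1 = κ' m / κ a m := hqM M hM
    have := coronaSum_lt (hκ a) h0 (hM.2.2 _ (hqM M hM)) (fun j => by rw [hqm]; exact hm j)
      (l := (q M).2) (by
        obtain ⟨p, hpl, h⟩ := hp M hM
        rw [hqm]
        exact ⟨p, hpl, h.imp (fun h => lt_of_le_of_ne (hm _) h)
          (fun h => lt_of_le_of_ne (hm _) h)⟩)
    rw [ha M hM, hq' M hM] at this
    exact lt_irrefl _ this
  funext i
  have hi : i ∈ M := hMuniv ▸ Set.mem_univ i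
  have h2 : i₀ ∈ M := hMuniv ▸ Set.mem_univ i₀
  have h3 : κ' i / κ a i = 1 := by
    rw [hMdef, Set.mem_ofPred_eq] at hi h2
    rw [hi, ← h2, hi₀, hi₀', div_one]
  exact ((div_eq_one_iff_eq (hκ a i).ne').1 h3).symm

/-! ### Simplicial complexes that tessellate the plane -/

section Complex

variable {d : ℕ} {K : Geometry.SimplicialComplex ℝ (EuclideanSpace ℝ (Fin d))}

lemma IsTessellation.isClosed_biUnion (hK : IsTessellation K)
    {F : Set (Finset (EuclideanSpace ℝ (Fin d)))} (hF : F ⊆ K.faces) :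
    IsClosed (⋃ t ∈ F, convexHull ℝ (t : Set (EuclideanSpace ℝ (Fin d)))) := by
  classical
  rw [hK.coherent.isClosed_iff]
  rintro _ ⟨s, hs, rfl⟩
  -- Only finitely many intersections with the simplex `s` occur: each is spanned by a subset of `s`.
  have hfin : {u : Finset (EuclideanSpace ℝ (Fin d)) | ∃ t ∈ F, u = s ∩ t}.Finite :=
    s.powerset.finite_toSet.subset (by
      rintro _ ⟨t, -, rfl⟩
      simp)
  have hclosed : IsClosed (⋃ u ∈ {u | ∃ t ∈ F, u = s ∩ t},
      convexHull ℝ ((u : Finset (EuclideanSpace ℝ (Fin d))) : Set (EuclideanSpace ℝ (Fin d)))) :=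
    hfin.isClosed_biUnion fun u _ => u.finite_toSet.isClosed_convexHull ℝ
  convert! hclosed.preimage (continuous_subtype_val (p := fun x => x ∈ convexHull ℝ (s : Set _)))
    using 1
  ext ⟨x, hx⟩
  simp only [Set.mem_preimage, Set.mem_iUnion, Set.mem_ofPred_eq, exists_prop]
  constructor
  · rintro ⟨t, ht, hxt⟩
    refine ⟨_, ⟨t, ht, rfl⟩, ?_⟩
    rw [Finset.coe_inter]
    exact K.inter_subset_convexHull hs (hF ht) ⟨hx, hxt⟩
  · rintro ⟨_, ⟨t, ht, rfl⟩, hxu⟩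
    exact ⟨t, ht, convexHull_mono (by simp) hxu⟩

lemma exists_mem_convexHull_of_card (hh : IsHomogeneousComplex K) (hK : IsTessellation K)
    (x : EuclideanSpace ℝ (Fin d)) :
    ∃ t ∈ K.faces, t.card = d + 1 ∧ x ∈ convexHull ℝ (t : Set (EuclideanSpace ℝ (Fin d))) := by
  have hx : x ∈ K.space := hK.space_eq ▸ Set.mem_univ x
  obtain ⟨s, hs, hxs⟩ := Geometry.SimplicialComplex.mem_space_iff.1 hx
  obtain ⟨t, ht, hst, hc⟩ := hh s hs
  exact ⟨t, ht, hc, convexHull_mono (by exact_mod_cast hst) hxs⟩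

/-- The star of a vertex is a neighbourhood of it. -/
lemma eventually_mem_star (hh : IsHomogeneousComplex K) (hK : IsTessellation K)
    {c : EuclideanSpace ℝ (Fin d)} (hc : {c} ∈ K.faces) :
    ∀ᶠ x in 𝓝 c, ∃ t ∈ K.faces, t.card = d + 1 ∧ c ∈ t ∧
      x ∈ convexHull ℝ (t : Set (EuclideanSpace ℝ (Fin d))) := by
  have hcl := hK.isClosed_biUnion (F := {t ∈ K.faces | c ∉ t}) fun t ht => ht.1
  have hmem : c ∈ (⋃ t ∈ {t ∈ K.faces | c ∉ t},
      convexHull ℝ (t : Set (EuclideanSpace ℝ (Fin d))))ᶜ := by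
    simp only [Set.mem_compl_iff, Set.mem_iUnion, not_exists]
    rintro t ⟨ht, hct⟩ hmem
    have := K.inter_subset_convexHull hc ht ⟨by simp, hmem⟩
    rw [Finset.coe_singleton] at this
    rw [Set.singleton_inter_eq_empty.2 (by simpa using hct)] at this
    simp at this
  filter_upwards [hcl.isOpen_compl.mem_nhds hmem] with x hx
  obtain ⟨t, ht, hcard, hxt⟩ := exists_mem_convexHull_of_card hh hK x
  refine ⟨t, ht, hcard, ?_, hxt⟩
  by_contra hct
  exact hx (Set.mem_biUnion (x := t) ⟨ht, hct⟩ hxt)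

/-- By connectedness of the plane, two kinds of vertices, both of which occur, occur together in
some simplex of full dimension. -/
lemma exists_mixed_simplex (hh : IsHomogeneousComplex K) (hK : IsTessellation K)
    (p : EuclideanSpace ℝ (Fin d) → Prop) {a b : EuclideanSpace ℝ (Fin d)}
    (ha : {a} ∈ K.faces) (hb : {b} ∈ K.faces) (hpa : p a) (hpb : ¬ p b) :
    ∃ t ∈ K.faces, t.card = d + 1 ∧ (∃ x ∈ t, p x) ∧ ∃ y ∈ t, ¬ p y := by
  classical
  by_contra! hno
  set F : Set (Finset (EuclideanSpace ℝ (Fin d))) := {t ∈ K.faces | ∀ x ∈ t, p x}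
  set G : Set (Finset (EuclideanSpace ℝ (Fin d))) := {t ∈ K.faces | ∀ x ∈ t, ¬ p x}
  have hF := hK.isClosed_biUnion (F := F) fun t ht => ht.1
  have hG := hK.isClosed_biUnion (F := G) fun t ht => ht.1
  have hcompl : (⋃ t ∈ G, convexHull ℝ (t : Set (EuclideanSpace ℝ (Fin d)))) =
      (⋃ t ∈ F, convexHull ℝ (t : Set (EuclideanSpace ℝ (Fin d))))ᶜ := by
    ext x
    simp only [Set.mem_iUnion, Set.mem_compl_iff, not_exists, exists_prop, not_and]
    constructor
    · rintro ⟨t, ht, hxt⟩ s hs hxs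
      have hne := convexHull_nonempty_iff.1
        ⟨x, K.inter_subset_convexHull ht.1 hs.1 ⟨hxt, hxs⟩⟩
      obtain ⟨y, hyt, hys⟩ := hne
      exact ht.2 y hyt (hs.2 y hys)
    · intro hx
      obtain ⟨t, ht, hcard, hxt⟩ := exists_mem_convexHull_of_card hh hK x
      refine ⟨t, ⟨ht, fun y hy hpy => hx t ⟨ht, ?_⟩ hxt⟩, hxt⟩
      exact hno t ht hcard ⟨y, hy, hpy⟩
  have hclopen : IsClopen (⋃ t ∈ F, convexHull ℝ (t : Set (EuclideanSpace ℝ (Fin d)))) :=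
    ⟨hF, by rw [← isClosed_compl_iff, ← hcompl]; exact hG⟩
  rcases isClopen_iff.1 hclopen with h | h
  · have : a ∈ (⋃ t ∈ F, convexHull ℝ (t : Set (EuclideanSpace ℝ (Fin d)))) :=
      Set.mem_biUnion (x := {a}) ⟨ha, by simpa using hpa⟩ (by simp)
    simp [h] at this
  · have : b ∈ (⋃ t ∈ G, convexHull ℝ (t : Set (EuclideanSpace ℝ (Fin d)))) :=
      Set.mem_biUnion (x := {b}) ⟨hb, by simpa using hpb⟩ (by simp)
    simp [hcompl, h] at this

end Complex

/-! ### Areas of sectors -/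

lemma Complex.volume_sector {I : Set ℝ} (hI : MeasurableSet I)
    (hI' : I ⊆ Set.Ioo (-Real.pi) Real.pi) :
    volume {z : ℂ | ‖z‖ < 1 ∧ z.arg ∈ I} = ENNReal.ofReal (1 / 2) * volume I := by
  have hmeas : MeasurableSet {z : ℂ | ‖z‖ < 1 ∧ z.arg ∈ I} :=
    (measurableSet_lt measurable_norm measurable_const).inter (Complex.measurable_arg hI)
  have htarget : MeasurableSet polarCoord.target := polarCoord.open_target.measurableSet
  have hhalf : ∫⁻ r in Set.Ioo (0 : ℝ) 1, ENNReal.ofReal r = ENNReal.ofReal (1 / 2) := by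
    rw [← ofReal_integral_eq_lintegral_ofReal, ← integral_Ioc_eq_integral_Ioo,
      ← intervalIntegral.integral_of_le zero_le_one]
    · simp
    · exact (continuous_id.integrableOn_Icc).mono_set Set.Ioo_subset_Icc_self
    · exact (ae_restrict_iff' measurableSet_Ioo).2 (ae_of_all _ fun r hr => hr.1.le)
  rw [← lintegral_indicator_one hmeas, ← Complex.lintegral_comp_polarCoord_symm]
  have hprod : ∫⁻ p in polarCoord.target, ENNReal.ofReal p.1 •
      ({z : ℂ | ‖z‖ < 1 ∧ z.arg ∈ I}.indicator 1 (Complex.polarCoord.symm p) : ENNReal) =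
      ∫⁻ p in Set.Ioo (0 : ℝ) 1 ×ˢ I, ENNReal.ofReal p.1 := by
    rw [← lintegral_indicator htarget, ← lintegral_indicator (measurableSet_Ioo.prod hI)]
    congr 1
    ext p
    by_cases hp : p ∈ polarCoord.target
    · have hp' : 0 < p.1 ∧ p.2 ∈ Set.Ioo (-Real.pi) Real.pi := by
        simpa [polarCoord_target] using hp
      have hn : ‖Complex.polarCoord.symm p‖ = p.1 := by
        rw [Complex.norm_polarCoord_symm, abs_of_pos hp'.1]
      have ha : (Complex.polarCoord.symm p).arg = p.2 := by
        rw [Complex.polarCoord_symm_apply]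
        simpa using Complex.arg_mul_cos_add_sin_mul_I hp'.1 ⟨hp'.2.1, hp'.2.2.le⟩
      rw [Set.indicator_of_mem hp]
      by_cases h : p.1 < 1 ∧ p.2 ∈ I
      · rw [Set.indicator_of_mem (by rwa [Set.mem_ofPred_eq, hn, ha]),
          Set.indicator_of_mem (show p ∈ Set.Ioo (0 : ℝ) 1 ×ˢ I from ⟨⟨hp'.1, h.1⟩, h.2⟩)]
        simp
      · rw [Set.indicator_of_notMem (by rwa [Set.mem_ofPred_eq, hn, ha]),
          Set.indicator_of_notMem (fun hmem : p ∈ Set.Ioo (0 : ℝ) 1 ×ˢ I =>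
            h ⟨hmem.1.2, hmem.2⟩)]
        simp
    · rw [Set.indicator_of_notMem hp, Set.indicator_of_notMem]
      intro hmem
      exact hp (by rw [polarCoord_target]; exact ⟨hmem.1.1, hI' hmem.2⟩)
  rw [hprod, Measure.volume_eq_prod, ← Measure.prod_restrict]
  have := lintegral_prod_mul (μ := volume.restrict (Set.Ioo (0 : ℝ) 1)) (ν := volume.restrict I)
    (f := fun r => ENNReal.ofReal r) (g := fun _ => 1)
    ENNReal.measurable_ofReal.aemeasurable aemeasurable_const
  simpa [hhalf] using this

/-- Coordinates adapted to a pair of directions: the first becomes the positive real axis and the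
second has the angle between them as its argument. -/
lemma exists_isometry_complex {a b : EuclideanSpace ℝ (Fin 2)} (ha : a ≠ 0) (hb : b ≠ 0) :
    ∃ f : EuclideanSpace ℝ (Fin 2) ≃ₗᵢ[ℝ] ℂ, f a = (‖a‖ : ℂ) ∧
      f b = ‖b‖ * Complex.exp (InnerProductGeometry.angle a b * Complex.I) := by
  have g : EuclideanSpace ℝ (Fin 2) ≃ₗᵢ[ℝ] ℂ := Complex.orthonormalBasisOneI.repr.symm
  have hna : (‖a‖ : ℂ) ≠ 0 := by simpa using ha
  have hu : ‖(starRingEnd ℂ) (g a) / ‖a‖‖ = 1 := by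
    rw [norm_div, RCLike.norm_conj, g.norm_map]
    simp [ha]
  obtain ⟨u, hu'⟩ : ∃ u : Circle, (u : ℂ) = (starRingEnd ℂ) (g a) / ‖a‖ :=
    ⟨⟨_, by simpa [Submonoid.unitSphere] using hu⟩, rfl⟩
  set f₁ := g.trans (rotation u)
  have hf₁ : f₁ a = (‖a‖ : ℂ) := by
    have : (starRingEnd ℂ) (g a) * g a = (‖a‖ : ℂ) ^ 2 := by
      rw [mul_comm, Complex.mul_conj', g.norm_map]
    simp only [f₁, LinearIsometryEquiv.trans_apply, rotation_apply]
    rw [hu', div_mul_eq_mul_div, this]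
    field_simp
  obtain ⟨f, hfa, him⟩ : ∃ f : EuclideanSpace ℝ (Fin 2) ≃ₗᵢ[ℝ] ℂ, f a = (‖a‖ : ℂ) ∧
      0 ≤ (f b).im := by
    by_cases h : 0 ≤ (f₁ b).im
    · exact ⟨f₁, hf₁, h⟩
    · refine ⟨f₁.trans Complex.conjLIE, by simp [hf₁], ?_⟩
      simp only [LinearIsometryEquiv.trans_apply, Complex.conjLIE_apply, Complex.conj_im]
      linarith
  refine ⟨f, hfa, ?_⟩
  have hfb : f b ≠ 0 := by simpa using hb
  have hangle : InnerProductGeometry.angle a b = (f b).arg := by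
    rw [← f.toLinearIsometry.angle_map a b]
    simp only [LinearIsometryEquiv.coe_toLinearIsometry]
    rw [hfa, ← abs_of_nonneg (Complex.arg_nonneg_iff.2 him), ← Complex.angle_one_left hfb,
      ← InnerProductGeometry.angle_smul_left_of_pos 1 (f b) (norm_pos_iff.2 ha)]
    simp
  rw [hangle, ← f.norm_map b, Complex.norm_mul_exp_arg_mul_I]

lemma arg_mem_Icc_of_cone {θ s t : ℝ} (h0 : 0 < θ) (hπ : θ < Real.pi) (hs : 0 ≤ s) (ht : 0 ≤ t) :
    ((s : ℂ) + t * Complex.exp (θ * Complex.I)).arg ∈ Set.Icc 0 θ := by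
  set z := (s : ℂ) + t * Complex.exp (θ * Complex.I) with hz
  have hsin : 0 < Real.sin θ := Real.sin_pos_of_pos_of_lt_pi h0 hπ
  have hre : z.re = s + t * Real.cos θ := by
    simp [hz, Complex.exp_ofReal_mul_I_re]
  have him : z.im = t * Real.sin θ := by
    simp [hz, Complex.exp_ofReal_mul_I_im]
  have harg : 0 ≤ z.arg := Complex.arg_nonneg_iff.2 (by rw [him]; positivity)
  refine ⟨harg, ?_⟩
  by_contra! hlt
  have hz0 : z ≠ 0 := by
    rintro h
    rw [h, Complex.arg_zero] at hlt
    linarith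
  have h1 : 0 < Real.sin (z.arg - θ) :=
    Real.sin_pos_of_pos_of_lt_pi (by linarith) (by linarith [Complex.arg_le_pi z])
  have h2 : 0 < ‖z‖ * Real.sin (z.arg - θ) := mul_pos (norm_pos_iff.2 hz0) h1
  have h3 : ‖z‖ * Real.sin (z.arg - θ) = - (s * Real.sin θ) := by
    rw [Real.sin_sub, mul_sub, ← mul_assoc, ← mul_assoc, Complex.norm_mul_sin_arg,
      Complex.norm_mul_cos_arg, hre, him]
    ring
  have := mul_nonneg hs hsin.le
  linarith

lemma exists_pos_of_arg_mem_Ioo {θ : ℝ} (hπ : θ < Real.pi) {z : ℂ}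
    (hz : z.arg ∈ Set.Ioo 0 θ) :
    ∃ s t : ℝ, 0 < s ∧ 0 < t ∧ z = s + t * Complex.exp (θ * Complex.I) := by
  obtain ⟨h0, hθ⟩ := hz
  have hsin : 0 < Real.sin θ := Real.sin_pos_of_pos_of_lt_pi (h0.trans hθ) hπ
  have hz0 : z ≠ 0 := by
    rintro rfl
    simp at h0
  have hn := norm_pos_iff.2 hz0
  -- The coefficients are given by the law of sines.
  refine ⟨‖z‖ * Real.sin (θ - z.arg) / Real.sin θ, ‖z‖ * Real.sin z.arg / Real.sin θ, ?_, ?_, ?_⟩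
  · have := Real.sin_pos_of_pos_of_lt_pi (x := θ - z.arg) (by linarith) (by linarith)
    positivity
  · have := Real.sin_pos_of_pos_of_lt_pi h0 (by linarith)
    positivity
  · rw [Real.sin_sub, mul_sub]
    apply Complex.ext
    · simp only [Complex.add_re, Complex.ofReal_re, Complex.re_ofReal_mul,
        Complex.exp_ofReal_mul_I_re]
      rw [← Complex.norm_mul_cos_arg z]
      field_simp
      ring
    · simp only [Complex.add_im, Complex.ofReal_im, Complex.im_ofReal_mul,
        Complex.exp_ofReal_mul_I_im]
      rw [← Complex.norm_mul_sin_arg z]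
      field_simp
      ring

/-- The part of the unit disc in the cone spanned by two directions has half their angle as its
area. This is stated by enclosing sets so that it serves both the open and the closed cone. -/
lemma exists_sectors {a b : EuclideanSpace ℝ (Fin 2)} (hab : LinearIndependent ℝ ![a, b]) :
    (∃ S, MeasurableSet S ∧ volume S = ENNReal.ofReal (InnerProductGeometry.angle a b / 2) ∧
      S ⊆ Metric.ball 0 1 ∧ ∀ x ∈ S, ∃ s t : ℝ, 0 < s ∧ 0 < t ∧ x = s • a + t • b) ∧
    ∃ S, volume S = ENNReal.ofReal (InnerProductGeometry.angle a b / 2) ∧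
      ∀ s t : ℝ, 0 ≤ s → 0 ≤ t → ‖s • a + t • b‖ < 1 → s • a + t • b ∈ S := by
  have ha : a ≠ 0 := hab.ne_zero 0
  have hb : b ≠ 0 := hab.ne_zero 1
  have hna := norm_pos_iff.2 ha
  have hnb := norm_pos_iff.2 hb
  set θ := InnerProductGeometry.angle a b with hθ
  have h0 : 0 < θ := by
    refine lt_of_le_of_ne (InnerProductGeometry.angle_nonneg _ _) fun h => ?_
    obtain ⟨-, r, -, hr⟩ := InnerProductGeometry.angle_eq_zero_iff.1 h.symm
    have := LinearIndependent.pair_iff.1 hab r (-1) (by rw [hr]; simp)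
    simp at this
  have hπ : θ < Real.pi := by
    refine lt_of_le_of_ne (InnerProductGeometry.angle_le_pi _ _) fun h => ?_
    obtain ⟨-, r, -, hr⟩ := InnerProductGeometry.angle_eq_pi_iff.1 h
    have := LinearIndependent.pair_iff.1 hab r (-1) (by rw [hr]; simp)
    simp at this
  obtain ⟨f, hfa, hfb⟩ := exists_isometry_complex ha hb
  rw [← hθ] at hfb
  have hmp : MeasurePreserving f := f.measurePreserving
  have hemb : MeasurableEmbedding f := f.toHomeomorph.measurableEmbedding
  have hval : ENNReal.ofReal (1 / 2) * ENNReal.ofReal (θ - 0) = ENNReal.ofReal (θ / 2) := by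
    rw [← ENNReal.ofReal_mul (by norm_num)]
    congr 1
    ring
  refine ⟨⟨f ⁻¹' {z : ℂ | ‖z‖ < 1 ∧ z.arg ∈ Set.Ioo 0 θ}, ?_, ?_, ?_, ?_⟩,
    f ⁻¹' {z : ℂ | ‖z‖ < 1 ∧ z.arg ∈ Set.Icc 0 θ}, ?_, ?_⟩
  · exact hemb.measurable ((measurableSet_lt measurable_norm measurable_const).inter
      (Complex.measurable_arg measurableSet_Ioo))
  · rw [hmp.measure_preimage_emb hemb, Complex.volume_sector measurableSet_Ioo, Real.volume_Ioo,
      hval]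
    exact fun x hx => ⟨by linarith [hx.1, Real.pi_pos], by linarith [hx.2]⟩
  · intro x hx
    simpa using hx.1
  · intro x hx
    obtain ⟨s, t, hs, ht, hst⟩ := exists_pos_of_arg_mem_Ioo hπ hx.2
    refine ⟨s / ‖a‖, t / ‖b‖, by positivity, by positivity, f.injective ?_⟩
    have hna' : (‖a‖ : ℂ) ≠ 0 := by simpa using ha
    have hnb' : (‖b‖ : ℂ) ≠ 0 := by simpa using hb
    rw [hst, map_add, map_smul, map_smul, hfa, hfb]
    simp only [Complex.real_smul, Complex.ofReal_div]
    field_simp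
  · rw [hmp.measure_preimage_emb hemb, Complex.volume_sector measurableSet_Icc, Real.volume_Icc,
      hval]
    exact fun x hx => ⟨by linarith [hx.1, Real.pi_pos], by linarith [hx.2]⟩
  · intro s t hs ht hst
    refine ⟨by rwa [f.norm_map], ?_⟩
    have := arg_mem_Icc_of_cone h0 hπ (mul_nonneg hs hna.le) (mul_nonneg ht hnb.le)
    convert! this using 2
    rw [map_add, map_smul, map_smul, hfa, hfb]
    simp [mul_assoc]

/-! ### The angles of the triangles around a vertex -/

section Star

local notation "V" => EuclideanSpace ℝ (Fin 2)

lemma mem_convexHull_triple_iff {c a b x : V} (hca : c ≠ a) (hcb : c ≠ b) (hab : a ≠ b) :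
    x ∈ convexHull ℝ (({c, a, b} : Finset V) : Set V) ↔
      ∃ s t : ℝ, 0 ≤ s ∧ 0 ≤ t ∧ s + t ≤ 1 ∧ x = c + (s • (a - c) + t • (b - c)) := by
  rw [Finset.mem_convexHull']
  have hc : c ∉ ({a, b} : Finset V) := by simp [hca, hcb]
  have ha : a ∉ ({b} : Finset V) := by simp [hab]
  simp only [Finset.sum_insert hc, Finset.sum_insert ha, Finset.sum_singleton,
    Finset.forall_mem_insert, Finset.mem_singleton, forall_eq]
  constructor
  · rintro ⟨w, ⟨h0, h1, h2⟩, hw, rfl⟩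
    refine ⟨w a, w b, h1, h2, by linarith, ?_⟩
    rw [show w c = 1 - w a - w b by linarith]
    module
  · rintro ⟨s, t, hs, ht, hst, rfl⟩
    classical
    refine ⟨fun y => if y = a then s else if y = b then t else 1 - s - t, ?_, ?_, ?_⟩
    · simp only [hca, hcb, hab.symm, if_true, if_false]
      exact ⟨by linarith, hs, ht⟩
    · simp only [hca, hcb, hab.symm, if_true, if_false]
      ring
    · simp only [hca, hcb, hab.symm, if_true, if_false]
      module

variable {K : Geometry.SimplicialComplex ℝ V}

lemma exists_triangle_eq {t : Finset V} (ht : t ∈ K.faces) (hcard : t.card = 3) {c : V}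
    (hc : c ∈ t) : ∃ a b, t = {c, a, b} ∧ c ≠ a ∧ c ≠ b ∧ a ≠ b ∧
      LinearIndependent ℝ ![a - c, b - c] := by
  obtain ⟨a, b, hab, he⟩ := Finset.card_eq_two.1
    (show (t.erase c).card = 2 by rw [Finset.card_erase_of_mem hc, hcard])
  have hte : t = {c, a, b} := by rw [← he, Finset.insert_erase hc]
  have hca : c ≠ a := by
    rintro rfl
    exact Finset.notMem_erase c t (he ▸ by simp)
  have hcb : c ≠ b := by
    rintro rfl
    exact Finset.notMem_erase c t (he ▸ by simp)
  refine ⟨a, b, hte, hca, hcb, hab, ?_⟩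
  have hinj : Function.Injective (![⟨c, by simp [hte]⟩, ⟨a, by simp [hte]⟩,
      ⟨b, by simp [hte]⟩] : Fin 3 → t) := by
    intro i j hij
    fin_cases i <;> fin_cases j <;> simp_all [Ne.symm]
  have h := (K.indep ht).comp_embedding ⟨_, hinj⟩
  rw [affineIndependent_iff_linearIndependent_vsub ℝ _ (0 : Fin 3)] at h
  have h2 := h.comp (![⟨1, by simp⟩, ⟨2, by simp⟩] : Fin 2 → {x : Fin 3 // x ≠ 0}) (by
    intro i j hij
    fin_cases i <;> fin_cases j <;> simp_all)
  convert! h2 using 1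
  ext i : 1
  fin_cases i <;> simp

/-- The open cones at a common vertex of two distinct triangles are disjoint. -/
lemma cones_disjoint {c a b a' b' : V} (ht : {c, a, b} ∈ K.faces) (ht' : {c, a', b'} ∈ K.faces)
    (hcard : ({c, a', b'} : Finset V).card ≤ ({c, a, b} : Finset V).card)
    (hne : ({c, a, b} : Finset V) ≠ {c, a', b'})
    (hca : c ≠ a) (hcb : c ≠ b) (hab : a ≠ b) (hca' : c ≠ a') (hcb' : c ≠ b') (hab' : a' ≠ b')
    (hind : LinearIndependent ℝ ![a - c, b - c]) {s t s' t' : ℝ} (hs : 0 < s) (ht0 : 0 < t)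
    (hs' : 0 < s') (ht0' : 0 < t')
    (h : s • (a - c) + t • (b - c) = s' • (a' - c) + t' • (b' - c)) : False := by
  classical
  -- Scaling towards `c` moves the common point into both triangles.
  set δ := (s + t + s' + t')⁻¹ with hδ
  have hδ0 : 0 < δ := by positivity
  have hδ1 : δ * (s + t + s' + t') = 1 := inv_mul_cancel₀ (by positivity)
  have h1 : c + ((δ * s) • (a - c) + (δ * t) • (b - c)) ∈
      convexHull ℝ (({c, a, b} : Finset V) : Set V) :=
    (mem_convexHull_triple_iff hca hcb hab).2
      ⟨_, _, by positivity, by positivity, by nlinarith, rfl⟩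
  have h2 : c + ((δ * s) • (a - c) + (δ * t) • (b - c)) ∈
      convexHull ℝ (({c, a', b'} : Finset V) : Set V) := by
    refine (mem_convexHull_triple_iff hca' hcb' hab').2
      ⟨δ * s', δ * t', by positivity, by positivity, by nlinarith, ?_⟩
    rw [mul_smul, mul_smul, mul_smul, mul_smul, ← smul_add, ← smul_add, h]
  have h3 := K.inter_subset_convexHull ht ht' ⟨h1, h2⟩
  -- The common face misses a vertex other than `c`, hence it lies on a line through `c`.
  have hmiss : a ∉ ({c, a', b'} : Finset V) ∨ b ∉ ({c, a', b'} : Finset V) := by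
    by_contra! hcon
    refine hne (Finset.eq_of_subset_of_card_le (fun x hx => ?_) hcard)
    simp only [Finset.mem_insert, Finset.mem_singleton] at hx
    rcases hx with rfl | rfl | rfl
    · simp
    · exact hcon.1
    · exact hcon.2
  rcases hmiss with hm | hm
  · have hsub : ((({c, a, b} : Finset V) : Set V) ∩ (({c, a', b'} : Finset V) : Set V)) ⊆
        {c, b} := by
      rintro x ⟨hx, hx'⟩
      simp only [Finset.coe_insert, Finset.coe_singleton, Set.mem_insert_iff,
        Set.mem_singleton_iff] at hx ⊢
      rcases hx with rfl | rfl | rfl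
      · simp
      · exact absurd (Finset.mem_coe.1 hx') hm
      · simp
    have h4 := convexHull_mono hsub h3
    rw [convexHull_pair, segment_eq_image'] at h4
    obtain ⟨w, -, hw⟩ := h4
    have h5 := LinearIndependent.pair_iff.1 hind (δ * s) (δ * t - w) (by
      rw [sub_smul, ← add_sub_assoc, sub_eq_zero]
      exact (add_left_cancel hw).symm)
    exact (mul_pos hδ0 hs).ne' h5.1
  · have hsub : ((({c, a, b} : Finset V) : Set V) ∩ (({c, a', b'} : Finset V) : Set V)) ⊆
        {c, a} := by
      rintro x ⟨hx, hx'⟩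
      simp only [Finset.coe_insert, Finset.coe_singleton, Set.mem_insert_iff,
        Set.mem_singleton_iff] at hx ⊢
      rcases hx with rfl | rfl | rfl
      · simp
      · simp
      · exact absurd (Finset.mem_coe.1 hx') hm
    have h4 := convexHull_mono hsub h3
    rw [convexHull_pair, segment_eq_image'] at h4
    obtain ⟨w, -, hw⟩ := h4
    have h5 := LinearIndependent.pair_iff.1 hind (δ * s - w) (δ * t) (by
      rw [sub_smul, sub_add_eq_add_sub, sub_eq_zero]
      exact (add_left_cancel hw).symm)
    exact (mul_pos hδ0 ht0).ne' h5.2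

lemma volume_ball_one : volume (Metric.ball (0 : V) 1) = ENNReal.ofReal Real.pi := by
  rw [InnerProductSpace.volume_ball_of_dim_even (k := 1) (by simp)]
  simp

/-- The triangles around a vertex `c` are finite in number, if their angles at `c` are bounded
below, and then these angles add up to `2π`: the open cones of the triangles are disjoint and the
closed ones cover the plane, so that the areas of the sectors of the unit disc add up to `π`. -/
theorem exists_star_angle_sum (hh : IsHomogeneousComplex K) (hK : IsTessellation K) {c : V}
    (hc : {c} ∈ K.faces) {a b : Finset V → V}
    (hab : ∀ t ∈ K.faces, t.card = 3 → c ∈ t → t = {c, a t, b t} ∧ c ≠ a t ∧ c ≠ b t ∧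
      a t ≠ b t ∧ LinearIndependent ℝ ![a t - c, b t - c])
    {δ : ℝ} (hδ : 0 < δ) (hangle : ∀ t ∈ K.faces, t.card = 3 → c ∈ t →
      δ ≤ InnerProductGeometry.angle (a t - c) (b t - c)) :
    ∃ T : Finset (Finset V), (∀ t, t ∈ T ↔ t ∈ K.faces ∧ t.card = 3 ∧ c ∈ t) ∧
      ∑ t ∈ T, InnerProductGeometry.angle (a t - c) (b t - c) = 2 * Real.pi := by
  classical
  set 𝒯 : Set (Finset V) := {t | t ∈ K.faces ∧ t.card = 3 ∧ c ∈ t} with h𝒯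
  have hsec := fun t (ht : t ∈ 𝒯) => exists_sectors (hab t ht.1 ht.2.1 ht.2.2).2.2.2.2
  choose! S hSmeas hSvol hSball hScone using fun t ht => (hsec t ht).1
  choose! S' hSvol' hScone' using fun t ht => (hsec t ht).2
  have hle : ∀ T : Finset (Finset V), (T : Set (Finset V)) ⊆ 𝒯 →
      ∑ t ∈ T, InnerProductGeometry.angle (a t - c) (b t - c) ≤ 2 * Real.pi := by
    intro T hT
    have hdisj : (T : Set (Finset V)).PairwiseDisjoint S := by
      intro t ht t' ht' hne
      refine Set.disjoint_left.2 fun x hx hx' => ?_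
      obtain ⟨hte, h1, h2, h3, h4⟩ := hab t (hT ht).1 (hT ht).2.1 (hT ht).2.2
      obtain ⟨hte', h1', h2', h3', h4'⟩ := hab t' (hT ht').1 (hT ht').2.1 (hT ht').2.2
      obtain ⟨s, u, hs, hu, hx1⟩ := hScone t (hT ht) x hx
      obtain ⟨s', u', hs', hu', hx2⟩ := hScone t' (hT ht') x hx'
      refine cones_disjoint (K := K) (c := c) (a := a t) (b := b t) (a' := a t') (b' := b t')
        ?_ ?_ ?_ ?_ h1 h2 h3 h1' h2' h3' h4 hs hu hs' hu' (hx1.symm.trans hx2)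
      · rw [← hte]; exact (hT ht).1
      · rw [← hte']; exact (hT ht').1
      · rw [← hte, ← hte', (hT ht).2.1, (hT ht').2.1]
      · rw [← hte, ← hte']; exact hne
    have hvol : volume (⋃ t ∈ T, S t) ≤ volume (Metric.ball (0 : V) 1) :=
      measure_mono (Set.iUnion₂_subset fun t ht => hSball t (hT ht))
    rw [measure_biUnion_finset hdisj fun t ht => hSmeas t (hT ht),
      Finset.sum_congr rfl fun t ht => hSvol t (hT ht), volume_ball_one,
      ← ENNReal.ofReal_sum_of_nonneg fun t _ =>
        div_nonneg (InnerProductGeometry.angle_nonneg _ _) zero_le_two,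
      ENNReal.ofReal_le_ofReal_iff Real.pi_pos.le, ← Finset.sum_div] at hvol
    linarith
  have hfin : 𝒯.Finite := by
    by_contra hinf
    obtain ⟨N, hN⟩ := exists_nat_gt (2 * Real.pi / δ)
    obtain ⟨T, hT, hcard⟩ := Set.Infinite.exists_subset_card_eq hinf N
    have h1 := Finset.card_nsmul_le_sum T
      (fun t => InnerProductGeometry.angle (a t - c) (b t - c)) δ
      fun t ht => hangle t (hT ht).1 (hT ht).2.1 (hT ht).2.2
    rw [div_lt_iff₀ hδ] at hN
    rw [hcard, nsmul_eq_mul] at h1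
    linarith [hle T hT]
  refine ⟨hfin.toFinset, fun t => by rw [hfin.mem_toFinset]; rfl, le_antisymm (hle _ (by simp)) ?_⟩
  have hcover : Metric.ball (0 : V) 1 ⊆ ⋃ t ∈ hfin.toFinset, S' t := by
    intro x hx
    have hlim : Tendsto (fun ε : ℝ => c + ε • x) (𝓝[>] 0) (𝓝 c) := by
      have : Tendsto (fun ε : ℝ => c + ε • x) (𝓝 0) (𝓝 (c + (0 : ℝ) • x)) :=
        (by fun_prop : Continuous fun ε : ℝ => c + ε • x).tendsto 0
      rw [zero_smul, add_zero] at this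
      exact this.mono_left nhdsWithin_le_nhds
    obtain ⟨ε, ⟨t, ht, hcard, hct, hxt⟩, hε⟩ :=
      ((hlim.eventually (eventually_mem_star hh hK hc)).and self_mem_nhdsWithin).exists
    have hε : 0 < ε := hε
    have ht𝒯 : t ∈ 𝒯 := ⟨ht, hcard, hct⟩
    obtain ⟨hte, h1, h2, h3, -⟩ := hab t ht hcard hct
    rw [hte, mem_convexHull_triple_iff h1 h2 h3] at hxt
    obtain ⟨s, u, hs, hu, -, hsu⟩ := hxt
    have hxe : x = (ε⁻¹ * s) • (a t - c) + (ε⁻¹ * u) • (b t - c) := by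
      rw [mul_smul, mul_smul, ← smul_add, ← add_left_cancel hsu, inv_smul_smul₀ hε.ne']
    refine Set.mem_biUnion (hfin.mem_toFinset.2 ht𝒯) ?_
    rw [hxe]
    refine hScone' t ht𝒯 _ _ (by positivity) (by positivity) ?_
    rw [← hxe]
    simpa using hx
  have hvol := (measure_mono hcover).trans (measure_biUnion_finset_le (μ := volume) _ _)
  rw [Finset.sum_congr rfl fun t ht => hSvol' t (hfin.mem_toFinset.1 ht), volume_ball_one,
    ← ENNReal.ofReal_sum_of_nonneg fun t _ =>
      div_nonneg (InnerProductGeometry.angle_nonneg _ _) zero_le_two,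
    ENNReal.ofReal_le_ofReal_iff (Finset.sum_nonneg fun t _ =>
      div_nonneg (InnerProductGeometry.angle_nonneg _ _) zero_le_two), ← Finset.sum_div] at hvol
  linarith

/-! ### Coronas in compact packings -/

/-- The law of cosines for the centres of three mutually tangent discs. -/
lemma angle_eq_cornerAngle {c a b : V} {x y z : ℝ} (hx : 0 < x) (hy : 0 < y) (hz : 0 < z)
    (hca : dist c a = x + y) (hcb : dist c b = x + z) (hab : dist a b = y + z) :
    InnerProductGeometry.angle (a - c) (b - c) = cornerAngle (x / y) (x / z) := by
  unfold InnerProductGeometry.angle cornerAngle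
  rw [real_inner_eq_norm_mul_self_add_norm_mul_self_sub_norm_sub_mul_self_div_two,
    sub_sub_sub_cancel_right, ← dist_eq_norm, ← dist_eq_norm, ← dist_eq_norm, dist_comm a c,
    dist_comm b c, hca, hcb, hab]
  congr 1
  field_simp
  ring

lemma IsSpherePacking.eq_of_center_eq {d : ℕ} {P : Set (Sphere (EuclideanSpace ℝ (Fin d)))}
    (hP : IsSpherePacking P) {A B : Sphere (EuclideanSpace ℝ (Fin d))} (hA : A ∈ P) (hB : B ∈ P)
    (h : A.center = B.center) : A = B := by
  by_contra hne
  refine Set.disjoint_left.1 (hP.disjoint_interiors hA hB hne)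
    (Metric.mem_ball_self (hP.radius_pos A hA)) ?_
  rw [h]
  exact Metric.mem_ball_self (hP.radius_pos B hB)

lemma isContactHyperedge_singleton {d : ℕ} {P : Set (Sphere (EuclideanSpace ℝ (Fin d)))}
    {A : Sphere (EuclideanSpace ℝ (Fin d))} (hA : A ∈ P) : IsContactHyperedge P {A.center} where
  nonempty := Finset.singleton_nonempty _
  subset_centers := by
    rw [Finset.coe_singleton, Set.singleton_subset_iff]
    exact ⟨A, hA, rfl⟩
  card_le := by simp
  tangent B _ C _ hB hC hne :=
    absurd ((Finset.mem_singleton.1 hB).trans (Finset.mem_singleton.1 hC).symm) hne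
  mem_of_mem_convexHull c _ hc := by simpa using hc

/-- In a compact disc packing with finitely many radii, two kinds of discs that both occur meet in
the corona of a disc of the first kind, and the angles in this corona add up to `2π`. -/
theorem IsCompactPacking.exists_corona {P : Set (Sphere V)} (hP : IsCompactPacking P)
    (hfin : (sphereRadii P).Finite) (M : Set ℝ) (hM : ∃ x ∈ sphereRadii P, x ∈ M)
    (hM' : ∃ x ∈ sphereRadii P, x ∉ M) :
    ∃ x ∈ sphereRadii P, x ∈ M ∧ ∃ l : List (ℝ × ℝ),
      (∀ p ∈ l, p.1 ∈ sphereRadii P ∧ p.2 ∈ sphereRadii P) ∧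
      (l.map fun p => cornerAngle (x / p.1) (x / p.2)).sum = 2 * Real.pi ∧
      ∃ p ∈ l, p.1 ∉ M ∨ p.2 ∉ M := by
  classical
  obtain ⟨hpack, K, hh, hK, hfaces⟩ := hP
  have hpos : ∀ x ∈ sphereRadii P, 0 < x := by
    rintro _ ⟨A, hA, rfl⟩
    exact hpack.radius_pos A hA
  obtain ⟨ρ, hρ⟩ : ∃ ρ : V → ℝ, ∀ A ∈ P, ρ A.center = A.radius := by
    refine ⟨fun c => if h : ∃ A ∈ P, A.center = c then h.choose.radius else 0, fun A hA => ?_⟩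
    have h : ∃ B ∈ P, B.center = A.center := ⟨A, hA, rfl⟩
    simp only [dif_pos h]
    rw [hpack.eq_of_center_eq h.choose_spec.1 hA h.choose_spec.2]
  have hρmem : ∀ t ∈ K.faces, ∀ c ∈ t, ρ c ∈ sphereRadii P := fun t ht c hc => by
    obtain ⟨A, hA, rfl⟩ := ((hfaces t).1 ht).subset_centers hc
    exact ⟨A, hA, (hρ A hA).symm⟩
  have hdist : ∀ t ∈ K.faces, ∀ a ∈ t, ∀ b ∈ t, a ≠ b → dist a b = ρ a + ρ b := by
    intro t ht a ha b hb hne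
    have he := (hfaces t).1 ht
    obtain ⟨A, hA, rfl⟩ := he.subset_centers ha
    obtain ⟨B, hB, rfl⟩ := he.subset_centers hb
    rw [hρ A hA, hρ B hB]
    exact (he.tangent A hA B hB ha hb hne).dist_center
  obtain ⟨_, ⟨A, hA, rfl⟩, hAM⟩ := hM
  obtain ⟨_, ⟨B, hB, rfl⟩, hBM⟩ := hM'
  obtain ⟨t₀, ht₀, hcard₀, ⟨c, hc, hcM⟩, e, he, heM⟩ :=
    exists_mixed_simplex hh hK (fun c => ρ c ∈ M)
      ((hfaces _).2 (isContactHyperedge_singleton hA))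
      ((hfaces _).2 (isContactHyperedge_singleton hB))
      (by rwa [hρ A hA]) (by rwa [hρ B hB])
  have hcR := hρmem t₀ ht₀ c hc
  refine ⟨ρ c, hcR, hcM, ?_⟩
  have hcK : {c} ∈ K.faces := K.down_closed ht₀ (by simpa using hc) (Finset.singleton_nonempty c)
  choose! a b hab using fun t (ht : t ∈ K.faces) (hcard : t.card = 3) (hct : c ∈ t) =>
    exists_triangle_eq ht hcard hct
  have hmem : ∀ t ∈ K.faces, t.card = 3 → c ∈ t → a t ∈ t ∧ b t ∈ t := fun t h1 h2 h3 => by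
    have := Finset.ext_iff.1 (hab t h1 h2 h3).1
    exact ⟨(this _).2 (by simp), (this _).2 (by simp)⟩
  have hcorner : ∀ t ∈ K.faces, t.card = 3 → c ∈ t →
      InnerProductGeometry.angle (a t - c) (b t - c) =
        cornerAngle (ρ c / ρ (a t)) (ρ c / ρ (b t)) := fun t h1 h2 h3 => by
    obtain ⟨-, hca, hcb, hne, -⟩ := hab t h1 h2 h3
    obtain ⟨ha, hb⟩ := hmem t h1 h2 h3
    exact angle_eq_cornerAngle (hpos _ hcR) (hpos _ (hρmem t h1 _ ha)) (hpos _ (hρmem t h1 _ hb))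
      (hdist t h1 _ h3 _ ha hca) (hdist t h1 _ h3 _ hb hcb) (hdist t h1 _ ha _ hb hne)
  obtain ⟨p, hp, hmin⟩ := Set.exists_min_image (sphereRadii P ×ˢ sphereRadii P)
    (fun p => cornerAngle (ρ c / p.1) (ρ c / p.2)) (hfin.prod hfin) ⟨(ρ c, ρ c), hcR, hcR⟩
  obtain ⟨T, hT, hsum⟩ := exists_star_angle_sum hh hK hcK hab
    (cornerAngle_pos (div_pos (hpos _ hcR) (hpos _ hp.1)).le
      (div_pos (hpos _ hcR) (hpos _ hp.2)).le)
    (fun t h1 h2 h3 => by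
      rw [hcorner t h1 h2 h3]
      exact hmin (ρ (a t), ρ (b t))
        ⟨hρmem t h1 _ (hmem t h1 h2 h3).1, hρmem t h1 _ (hmem t h1 h2 h3).2⟩)
  refine ⟨T.toList.map fun t => (ρ (a t), ρ (b t)), ?_, ?_, ?_⟩
  · intro q hq
    obtain ⟨t, ht, rfl⟩ := List.mem_map.1 hq
    obtain ⟨h1, h2, h3⟩ := (hT t).1 (Finset.mem_toList.1 ht)
    exact ⟨hρmem t h1 _ (hmem t h1 h2 h3).1, hρmem t h1 _ (hmem t h1 h2 h3).2⟩
  · rw [List.map_map, ← hsum, ← Finset.sum_map_toList]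
    congr 1
    refine List.map_congr_left fun t ht => ?_
    obtain ⟨h1, h2, h3⟩ := (hT t).1 (Finset.mem_toList.1 ht)
    exact (hcorner t h1 h2 h3).symm
  · refine ⟨(ρ (a t₀), ρ (b t₀)), List.mem_map.2
      ⟨t₀, Finset.mem_toList.2 ((hT t₀).2 ⟨ht₀, hcard₀, hc⟩), rfl⟩, ?_⟩
    rw [(hab t₀ ht₀ hcard₀ hc).1] at he
    simp only [Finset.mem_insert, Finset.mem_singleton] at he
    rcases he with rfl | rfl | rfl
    · exact absurd hcM heM
    · exact Or.inl heM
    · exact Or.inr heM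

end Star

/-! ### Finiteness -/

/-- Every set of radii, written increasingly and scaled to curvatures relative to the smallest
radius, is a curvature system with coronas. -/
lemma exists_curvatures {n : ℕ} [NeZero n] {R : Set ℝ} (hR : R ∈ radiusConfigurations 2 n) :
    ∃ κ : Fin n → ℝ, (∀ i, 0 < κ i) ∧ (∀ i, κ i ≤ 1) ∧ κ 0 = 1 ∧ HasCoronas κ ∧
      ∃ k, R = Set.range (fun i => κ k / κ i) ∧ ∀ i, κ k ≤ κ i := by
  obtain ⟨P, hP, rfl, hcard, hgreat⟩ := hR
  have hfin : (sphereRadii P).Finite := Set.finite_of_encard_eq_coe hcard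
  have hcard' : hfin.toFinset.card = n := by
    rw [hfin.encard_eq_coe_toFinset_card] at hcard
    exact_mod_cast hcard
  set r := hfin.toFinset.orderEmbOfFin hcard' with hr
  have hrange : Set.range r = sphereRadii P := by
    rw [hr, Finset.range_orderEmbOfFin, hfin.coe_toFinset]
  have hmem : ∀ i, r i ∈ sphereRadii P := fun i => hrange ▸ Set.mem_range_self i
  have hpos : ∀ i, 0 < r i := fun i => by
    obtain ⟨A, hA, h⟩ := hmem i
    exact h ▸ hP.1.radius_pos A hA
  obtain ⟨k, hk⟩ : 1 ∈ Set.range r := hrange ▸ hgreat.1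
  refine ⟨fun i => r 0 / r i, fun i => div_pos (hpos 0) (hpos i), fun i => ?_,
    div_self (hpos 0).ne', ?_, k, ?_, fun i => ?_⟩
  · exact (div_le_one (hpos i)).2 (r.monotone (Fin.zero_le i))
  · intro M hM hM'
    have hdiv : ∀ i j, r 0 / r j / (r 0 / r i) = r i / r j := fun i j => by
      have := (hpos 0).ne'
      have := (hpos i).ne'
      have := (hpos j).ne'
      field_simp
    have himage : ∀ i, r i ∈ r '' M ↔ i ∈ M := fun i => r.injective.mem_set_image
    obtain ⟨i₁, hi₁⟩ := hM
    obtain ⟨i₂, hi₂⟩ := (Set.ne_univ_iff_exists_notMem M).1 hM'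
    obtain ⟨x, -, ⟨i, hi, rfl⟩, l, hl, hsum, p, hp, hpM⟩ := hP.exists_corona hfin (r '' M)
      ⟨r i₁, hmem _, (himage _).2 hi₁⟩ ⟨r i₂, hmem _, fun h => hi₂ ((himage _).1 h)⟩
    have hinv : ∀ y ∈ sphereRadii P, r (Function.invFun r y) = y := fun y hy =>
      Function.invFun_eq (by rwa [← hrange] at hy)
    refine ⟨i, hi, l.map fun p => (Function.invFun r p.1, Function.invFun r p.2), ?_,
      _, List.mem_map.2 ⟨p, hp, rfl⟩, ?_⟩
    · rw [coronaSum, List.map_map, ← hsum]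
      congr 1
      refine List.map_congr_left fun q hq => ?_
      simp only [Function.comp_apply, hdiv, hinv _ (hl q hq).1, hinv _ (hl q hq).2]
    · rw [← himage, ← himage, hinv _ (hl p hp).1, hinv _ (hl p hp).2]
      exact hpM
  · rw [← hrange]
    congr 1
    funext i
    have := (hpos 0).ne'
    have := (hpos i).ne'
    simp only [hk]
    field_simp
  · simp only [hk]
    exact div_le_div_of_nonneg_left (hpos 0).le (hpos i) (hgreat.2 (hmem i))

theorem mainTheorem7 (n : ℕ) (hn : 2 ≤ n) : (radiusConfigurations 2 n).Finite := by
  have : NeZero n := ⟨by omega⟩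
  by_contra hinf
  have : Infinite (radiusConfigurations 2 n) := Set.infinite_coe_iff.2 hinf
  choose κ hκ h1 h0 hcor k hk hmin using
    fun R : radiusConfigurations 2 n => exists_curvatures R.2
  set 𝒰 := hyperfilter (radiusConfigurations 2 n)
  have hcompact : ∀ i, ∃ y ∈ Set.Icc (0 : ℝ) 1, Tendsto (fun R => κ R i) 𝒰 (𝓝 y) := fun i =>
    isCompact_Icc.ultrafilter_le_nhds' (𝒰.map fun R => κ R i)
      (Ultrafilter.mem_map.2 (Filter.univ_mem' fun R => ⟨(hκ R i).le, h1 R i⟩))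
  choose κ' _ hlim using hcompact
  have hev := eventually_eq_of_hasCoronas hκ h1 0 h0 hcor hlim
  -- The curvatures determine the radii, so only one configuration has the limit curvatures.
  have hsub : {R : radiusConfigurations 2 n | κ R = κ'}.Subsingleton := by
    intro R hR R' hR'
    have he : κ R = κ R' := hR.trans hR'.symm
    have hkk : κ R (k R) = κ R' (k R') :=
      le_antisymm (he ▸ hmin R (k R')) (he ▸ hmin R' (k R))
    apply Subtype.ext
    rw [hk R, hk R', hkk, he]
  exact notMem_hyperfilter_of_finite hsub.finite hev
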